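/- A Bayesian game $G$ with $M\ge 1$ optimizer actions, $N\ge 1$ learner actions and $C$ contexts consists of a probability distribution $(p_c)_{c\in[C]}$ on $[C]$ and utilities $u_O(i,j,c),u_L(i,j,c)\in[-1,1]$ for $i\in[M]$, $j\in[N]$, $c\in[C]$, extended bilinearly to mixed strategies $\alpha\in\Delta([M])$, $b\in\Delta([N])$. In each round the optimizer plays $\alpha\in\Delta([M])$ and the learner plays $\beta:[C]\to\Delta([N])$, and the optimizer receives the reward $u_O(\alpha,\beta)=\sum_{c}\sum_i\sum_j p_c\,\alpha_i\,\beta(c)_j\,u_O(i,j,c)$. A correlated equilibrium of $G$ is a family $(\mathcal F_c)_{c\in[C]}$ of distributions on $[M]\times[N]$ such that for all $c,c'\in[C]$ and all $\pi:[N]\to[N]$ $$\mathbb E_{(i,j)\sim\mathcal F_c}[u_L(i,j,c)]\ge \mathbb E_{(i,j)\sim\mathcal F_{c'}}[u_L(i,j,c)]\quad\text{and}\quad \mathbb E_{(i,j)\sim\mathcal F_c}[u_L(i,j,c)]\ge \mathbb E_{(i,j)\sim\mathcal F_{c}}[u_L(i,\pi(j),c)].$$ Let $\mathsf{CorrVal}(G)$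 be the maximum of $\sum_c p_c\,\mathbb E_{(i,j)\sim\mathcal F_c}[u_O(i,j,c)]$ over all correlated equilibria. A (deterministic, full-information) learning algorithm over $K$ arms outputs, given the number of rounds $T$ and the reward vectors $r^1,\dots,r^{t-1}$ of the earlier rounds, a distribution $\gamma^t\in\Delta([K])$. It is low-regret if there is a function $R(T)=o(T)$ such that $\max_{k}\sum_{t=1}^T r^t_k-\sum_{t=1}^T\langle\gamma^t,r^t\rangle\le R(T)$ for every $T$ and all $r^1,\dots,r^T\in[-1,1]^K$. Consider a learner who, for each $c\in[C]$ and $j\in[N]$, runs a low-regret algorithm $\mathcal A_{c,j}$ over $N+C$ arms. In round $t$, with $\gamma^t_{c,j}\in\Delta([N+C])$ the output of $\mathcal A_{c,j}$, the learner plays any $\beta^t:[C]\to\Delta([N])$ satisfying $$\beta^t(c)_j=\sum_{j'=1}^N\beta^t(c)_{j'}\Big(\gamma^t_{c,j',j}+\sum_{c'=1}^C\gamma^t_{c,j',N+c'}\,\beta^t(c')_j\Big)\qquad\text{for all } c\in[C],\ j\in[N];$$ the optimizer plays an arbitrary $\alpha^t\in\Delta([M])$; and each $\mathcal A_{c,j}$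 is updated with the reward vector $r^t_{c,j}\in[-1,1]^{N+C}$ given by $r^t_{c,j,j'}=\beta^t(c)_j\,u_L(\alpha^t,j',c)$ for $j'\in[N]$ and $r^t_{c,j,N+c'}=\beta^t(c)_j\,u_L(\alpha^t,\beta^t(c'),c)$ for $c'\in[C]$. Theorem. The maximum defining $\mathsf{CorrVal}(G)$ is attained, and there is a function $f(T)=o(T)$, depending only on $G$ and the algorithms $\mathcal A_{c,j}$, such that for every $T$, every choice of the optimizer's strategies $\alpha^1,\dots,\alpha^T$ and every choice of the solutions $\beta^1,\dots,\beta^T$, $$\sum_{t=1}^T u_O(\alpha^t,\beta^t)\le \mathsf{CorrVal}(G)\,T+f(T).$$ -/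

import Mathlib

open scoped BigOperators
open Filter Asymptotics

noncomputable section

/-! ### Online learning (fractional, full-information, deterministic) -/

/-- A deterministic online learning algorithm over a finite set `ι` of arms: given the number `T`
of rounds, the number `t` of rounds already played, and the `t` reward vectors revealed so far, it
outputs the distribution over arms to be played next. -/
structure LearningAlgorithm (ι : Type) [Fintype ι] where
  play : (T t : ℕ) → (Fin t → ι → ℝ) → stdSimplex ℝ ι

namespace LearningAlgorithm

variable {ι : Type} [Fintype ι]

/-- The part of a `T`-round sequence that precedes round `t` (rounds are `0, …, T - 1`). -/
def past {X : Type} {T : ℕ} (x : Fin T → X) (t : Fin T) : Fin (t : ℕ) → X :=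
  fun s => x (Fin.castLE t.isLt.le s)

/-- External regret on the reward sequence `r`: the reward of the best fixed arm in hindsight minus
the reward of the algorithm. -/
def externalRegret (A : LearningAlgorithm ι) {T : ℕ} (r : Fin T → ι → ℝ) : ℝ :=
  (⨆ k : ι, ∑ t : Fin T, r t k) -
    ∑ t : Fin T, ∑ k : ι, (A.play T t (past r t)).1 k * r t k

/-- The algorithm sustains `o(T)` external regret on every `T`-round instance with rewards in
`[-1, 1]`. -/
def IsLowRegret (A : LearningAlgorithm ι) : Prop :=
  ∃ R : ℕ → ℝ, (R =o[atTop] fun T : ℕ => (T : ℝ)) ∧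
    ∀ (T : ℕ) (r : Fin T → ι → ℝ), (∀ t k, r t k ∈ Set.Icc (-1 : ℝ) 1) →
      A.externalRegret r ≤ R T

end LearningAlgorithm

/-! ### Bayesian games -/

/-- A Bayesian game with `M` optimizer actions, `N` learner actions and `C` contexts. Context `c`
has probability `p c`; it is seen by the learner only. -/
structure BayesianGame (M N C : ℕ) where
  p : Fin C → ℝ
  p_nonneg : ∀ c, 0 ≤ p c
  p_sum : ∑ c, p c = 1
  uO : Fin M → Fin N → Fin C → ℝ
  uL : Fin M → Fin N → Fin C → ℝ
  uO_bdd : ∀ i j c, |uO i j c| ≤ 1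
  uL_bdd : ∀ i j c, |uL i j c| ≤ 1

namespace BayesianGame

variable {M N C : ℕ} (G : BayesianGame M N C)

/-- The learner's utility `u_L(α, j, c)`. -/
def learnerPure (α : stdSimplex ℝ (Fin M)) (j : Fin N) (c : Fin C) : ℝ :=
  ∑ i, α.1 i * G.uL i j c

/-- The learner's utility `u_L(α, b, c)` for a mixed strategy `b`. -/
def learnerMixed (α : stdSimplex ℝ (Fin M)) (b : stdSimplex ℝ (Fin N)) (c : Fin C) : ℝ :=
  ∑ i, ∑ j, α.1 i * b.1 j * G.uL i j c

/-- The optimizer's one-round reward `u_O(α, β)`. -/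
def optimizerReward (α : stdSimplex ℝ (Fin M)) (β : Fin C → stdSimplex ℝ (Fin N)) : ℝ :=
  ∑ c, ∑ i, ∑ j, G.p c * α.1 i * (β c).1 j * G.uO i j c

/-! ### Correlated equilibria (constraints for the learner only) -/

/-- The collection `F c` of distributions over action profiles is a correlated equilibrium: the
learner has no incentive to misreport the context and no incentive to swap actions. -/
def IsCorrelatedEquilibrium (F : Fin C → stdSimplex ℝ (Fin M × Fin N)) : Prop :=
  (∀ c c' : Fin C,
    ∑ a : Fin M × Fin N, (F c').1 a * G.uL a.1 a.2 c ≤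
      ∑ a : Fin M × Fin N, (F c).1 a * G.uL a.1 a.2 c) ∧
  (∀ (c : Fin C) (π : Fin N → Fin N),
    ∑ a : Fin M × Fin N, (F c).1 a * G.uL a.1 (π a.2) c ≤
      ∑ a : Fin M × Fin N, (F c).1 a * G.uL a.1 a.2 c)

/-- The optimizer's expected utility under the collection `F`. -/
def optimizerValue (F : Fin C → stdSimplex ℝ (Fin M × Fin N)) : ℝ :=
  ∑ c, G.p c * ∑ a : Fin M × Fin N, (F c).1 a * G.uO a.1 a.2 c

/-- The optimizer's values over all correlated equilibria. -/
def corrValues : Set ℝ :=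
  {v | ∃ F, G.IsCorrelatedEquilibrium F ∧ G.optimizerValue F = v}

/-- The correlated Stackelberg value. -/
def corrVal : ℝ := sSup G.corrValues

/-! ### The algorithm that swaps between contexts

The `N + C` arms are `Fin N ⊕ Fin C`: `Sum.inl j` stands for action `j`, `Sum.inr c` for
context `c`. -/

/-- `β` solves the quadratic system with coefficients `γ c j`. -/
def IsQuadraticFixedPoint (γ : Fin C → Fin N → stdSimplex ℝ (Fin N ⊕ Fin C))
    (β : Fin C → stdSimplex ℝ (Fin N)) : Prop :=
  ∀ (c : Fin C) (j : Fin N),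
    (β c).1 j = ∑ j' : Fin N, (β c).1 j' *
      ((γ c j').1 (Sum.inl j) + ∑ c' : Fin C, (γ c j').1 (Sum.inr c') * (β c').1 j)

/-- The reward vector passed to the sub-algorithm of `(c, j)` after a round in which the optimizer
played `α` and the learner played `β`. -/
def armReward (α : stdSimplex ℝ (Fin M)) (β : Fin C → stdSimplex ℝ (Fin N))
    (c : Fin C) (j : Fin N) : Fin N ⊕ Fin C → ℝ
  | Sum.inl j' => (β c).1 j * G.learnerPure α j' c
  | Sum.inr c' => (β c).1 j * G.learnerMixed α (β c') c

/-- `(α, β)` is a possible `T`-round play against a learner who runs the sub-algorithms `A c j`: in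
every round `t`, `β t` is a solution of the quadratic system whose coefficients are the current
outputs of the sub-algorithms. The optimizer's strategies `α t` are arbitrary. -/
def IsContextSwapPlay (A : Fin C → Fin N → LearningAlgorithm (Fin N ⊕ Fin C)) {T : ℕ}
    (α : Fin T → stdSimplex ℝ (Fin M)) (β : Fin T → Fin C → stdSimplex ℝ (Fin N)) : Prop :=
  ∀ t : Fin T, IsQuadraticFixedPoint
    (fun c j => (A c j).play T t
      (LearningAlgorithm.past (fun s => G.armReward (α s) (β s) c j) t))
    (β t)

end BayesianGame

end

/-!
The idea is to average. Let `F c` be the time average of the product distributions `αᵗ ⊗ βᵗ(c)`.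
The fixed-point equation makes the total reward collected by the sub-algorithms `A c 1, …, A c N`
equal to the learner's utility in context `c`. Hence, for every map `σ` from actions to arms, the
learner gains at most the sum of their regrets by replacing each action `j` by the arm `σ j`.
Constant maps to another context and maps into the actions are exactly the two kinds of deviation
in the definition of a correlated equilibrium, so `F` is an `ε`-approximate equilibrium with
`ε = o(T) / T`. As the space of families `F` is compact, the best value of an `ε`-approximate
equilibrium tends to `corrVal` as `ε → 0`, and `F` has the optimizer's average reward as its value.
-/

open scoped Topology

theorem eventually_forall_lt_of_isClosed {X Y α : Type*} [TopologicalSpace X] [CompactSpace X]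
    [TopologicalSpace Y] [Preorder α] {P : Y → X → Prop}
    (hP : IsClosed {q : Y × X | P q.1 q.2}) {v : X → α} (hv : UpperSemicontinuous v)
    {y₀ : Y} {a : α} (h : ∀ x, P y₀ x → v x < a) :
    ∀ᶠ y in 𝓝 y₀, ∀ x, P y x → v x < a := by
  suffices ∀ᶠ y in 𝓝 y₀, ∀ x ∈ Set.univ, P y x → v x < a by simpa using this
  refine isCompact_univ.eventually_forall_of_forall_eventually fun x _ => ?_
  by_cases hx : P y₀ x
  · filter_upwards [continuous_snd.continuousAt.eventually (hv x a (h x hx))] with q hq _ using hq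
  · filter_upwards [hP.isOpen_compl.mem_nhds hx] with q hq hPq using absurd hPq hq

section Distributions

variable {𝕜 κ ι τ : Type*} [Fintype κ] [Fintype ι] [Fintype τ]

/-- The distribution of a pair of independent samples, the first from `x` and the second
from `y`. -/
def productDistribution [Semiring 𝕜] [PartialOrder 𝕜] [IsOrderedRing 𝕜]
    (x : stdSimplex 𝕜 κ) (y : stdSimplex 𝕜 ι) : stdSimplex 𝕜 (κ × ι) :=
  ⟨fun a => x.1 a.1 * y.1 a.2, fun a => mul_nonneg (x.2.1 a.1) (y.2.1 a.2), by
    simp only [Fintype.sum_prod_type, ← Finset.mul_sum, y.2.2, mul_one, x.2.2]⟩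

theorem continuous_sum_stdSimplex_mul [Semiring 𝕜] [PartialOrder 𝕜] [TopologicalSpace 𝕜]
    [IsTopologicalSemiring 𝕜] {X : Type*} [TopologicalSpace X] {μ : X → stdSimplex 𝕜 κ}
    (hμ : Continuous μ) (g : κ → 𝕜) : Continuous fun x => ∑ a, (μ x).1 a * g a :=
  have hμ' : Continuous fun x => (μ x).1 := continuous_subtype_val.comp hμ
  continuous_finsetSum _ fun a _ => ((continuous_apply a).comp hμ').mul_const (g a)

variable [Field 𝕜] [LinearOrder 𝕜] [IsStrictOrderedRing 𝕜] [Nonempty τ]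

/-- The uniform mixture of a nonempty finite family of distributions. -/
def averageDistribution (μ : τ → stdSimplex 𝕜 κ) : stdSimplex 𝕜 κ :=
  ⟨fun a => (∑ t, (μ t).1 a) / Fintype.card τ,
    fun a => div_nonneg (Finset.sum_nonneg fun t _ => (μ t).2.1 a) (Nat.cast_nonneg _), by
    rw [← Finset.sum_div, Finset.sum_comm]
    simp [(μ _).2.2]⟩

theorem sum_averageDistribution_mul (μ : τ → stdSimplex 𝕜 κ) (g : κ → 𝕜) :
    ∑ a, (averageDistribution μ).1 a * g a =
      (∑ t, ∑ a, (μ t).1 a * g a) / Fintype.card τ := by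
  rw [Finset.sum_comm, Finset.sum_div]
  simp only [averageDistribution, div_mul_eq_mul_div, Finset.sum_mul]

end Distributions

namespace LearningAlgorithm

variable {ι : Type} [Fintype ι]

theorem sum_sub_sum_play_le_externalRegret (A : LearningAlgorithm ι) {T : ℕ}
    (r : Fin T → ι → ℝ) (k : ι) :
    ∑ t : Fin T, r t k - ∑ t : Fin T, ∑ l, (A.play T t (past r t)).1 l * r t l ≤
      A.externalRegret r :=
  sub_le_sub_right (le_ciSup (f := fun k => ∑ t, r t k) (Set.finite_range _).bddAbove k) _

theorem exists_common_externalRegret_bound {κ : Type*} [Finite κ]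
    {A : κ → LearningAlgorithm ι} (hA : ∀ k, (A k).IsLowRegret) :
    ∃ R : ℕ → ℝ, (R =o[atTop] fun T : ℕ => (T : ℝ)) ∧ (∀ T, 0 ≤ R T) ∧
      ∀ k (T : ℕ) (r : Fin T → ι → ℝ), (∀ t i, r t i ∈ Set.Icc (-1 : ℝ) 1) →
        (A k).externalRegret r ≤ R T := by
  have := Fintype.ofFinite κ
  choose R hRo hR using hA
  refine ⟨fun T => ∑ k, |R k T|, IsLittleO.fun_sum fun k _ => (hRo k).abs_left,
    fun T => Finset.sum_nonneg fun k _ => abs_nonneg _, fun k T r hr => ?_⟩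
  calc (A k).externalRegret r ≤ R k T := hR k T r hr
    _ ≤ |R k T| := le_abs_self _
    _ ≤ ∑ k, |R k T| :=
      Finset.single_le_sum (f := fun k => |R k T|) (fun k _ => abs_nonneg _) (Finset.mem_univ k)

end LearningAlgorithm

namespace BayesianGame

variable {M N C : ℕ} (G : BayesianGame M N C)

section Utilities

variable (α : stdSimplex ℝ (Fin M)) (β : Fin C → stdSimplex ℝ (Fin N)) (b : stdSimplex ℝ (Fin N))

theorem learnerMixed_eq_sum_learnerPure (c : Fin C) :
    G.learnerMixed α b c = ∑ j, b.1 j * G.learnerPure α j c := by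
  simp only [learnerMixed, learnerPure, Finset.mul_sum]
  rw [Finset.sum_comm]
  simp only [mul_assoc, mul_left_comm]

theorem sum_productDistribution_mul_uL (π : Fin N → Fin N) (c : Fin C) :
    ∑ a, (productDistribution α b).1 a * G.uL a.1 (π a.2) c =
      ∑ j, b.1 j * G.learnerPure α (π j) c := by
  simp only [productDistribution, Fintype.sum_prod_type_right, learnerPure, Finset.mul_sum,
    mul_left_comm, mul_assoc]

theorem learnerMixed_eq_sum_productDistribution (c : Fin C) :
    G.learnerMixed α b c = ∑ a, (productDistribution α b).1 a * G.uL a.1 a.2 c := by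
  rw [learnerMixed_eq_sum_learnerPure]
  exact (G.sum_productDistribution_mul_uL α b id c).symm

theorem optimizerReward_eq_optimizerValue :
    G.optimizerReward α β = G.optimizerValue fun c => productDistribution α (β c) := by
  simp only [optimizerReward, optimizerValue, productDistribution, Fintype.sum_prod_type,
    Finset.mul_sum, mul_assoc]

theorem learnerPure_mem_Icc (j : Fin N) (c : Fin C) :
    G.learnerPure α j c ∈ Set.Icc (-1 : ℝ) 1 :=
  (convex_Icc (-1 : ℝ) 1).sum_mem (fun i _ => α.2.1 i) α.2.2
    fun i _ => abs_le.mp (G.uL_bdd i j c)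

theorem learnerMixed_mem_Icc (c : Fin C) : G.learnerMixed α b c ∈ Set.Icc (-1 : ℝ) 1 := by
  rw [learnerMixed_eq_sum_learnerPure]
  exact (convex_Icc (-1 : ℝ) 1).sum_mem (fun j _ => b.2.1 j) b.2.2
    fun j _ => G.learnerPure_mem_Icc α j c

theorem armReward_mem_Icc (c : Fin C) (j : Fin N) (k : Fin N ⊕ Fin C) :
    G.armReward α β c j k ∈ Set.Icc (-1 : ℝ) 1 := by
  have scaled_mem {u : ℝ} (hu : u ∈ Set.Icc (-1 : ℝ) 1) : (β c).1 j * u ∈ Set.Icc (-1 : ℝ) 1 :=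
    (convex_Icc (-1 : ℝ) 1).smul_mem_of_zero_mem (by norm_num) hu
      (mem_Icc_of_mem_stdSimplex (β c).2 j)
  cases k with
  | inl j' => exact scaled_mem (G.learnerPure_mem_Icc α j' c)
  | inr c' => exact scaled_mem (G.learnerMixed_mem_Icc α (β c') c)

theorem sum_armReward_inr (c c' : Fin C) :
    ∑ j, G.armReward α β c j (Sum.inr c') = G.learnerMixed α (β c') c := by
  simp only [armReward, ← Finset.sum_mul, (β c).2.2, one_mul]

end Utilities

section Play

theorem sum_mul_armReward (w : stdSimplex ℝ (Fin N ⊕ Fin C)) (α : stdSimplex ℝ (Fin M))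
    (β : Fin C → stdSimplex ℝ (Fin N)) (c : Fin C) (j : Fin N) :
    ∑ k, w.1 k * G.armReward α β c j k =
      ∑ l, (β c).1 j * (w.1 (Sum.inl l) + ∑ c', w.1 (Sum.inr c') * (β c').1 l) *
        G.learnerPure α l c := by
  simp only [Fintype.sum_sum_type, armReward, learnerMixed_eq_sum_learnerPure, mul_add, add_mul,
    Finset.sum_add_distrib, Finset.mul_sum, Finset.sum_mul]
  congr 1
  · simp only [mul_assoc, mul_left_comm]
  · rw [Finset.sum_comm]
    simp only [mul_assoc, mul_left_comm]

theorem IsQuadraticFixedPoint.sum_mul_armReward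
    {γ : Fin C → Fin N → stdSimplex ℝ (Fin N ⊕ Fin C)} {β : Fin C → stdSimplex ℝ (Fin N)}
    (h : IsQuadraticFixedPoint γ β) (α : stdSimplex ℝ (Fin M)) (c : Fin C) :
    ∑ j, ∑ k, (γ c j).1 k * G.armReward α β c j k = G.learnerMixed α (β c) c := by
  simp only [G.sum_mul_armReward, G.learnerMixed_eq_sum_learnerPure]
  rw [Finset.sum_comm]
  simp only [← Finset.sum_mul, ← h c _]

variable {G} {A : Fin C → Fin N → LearningAlgorithm (Fin N ⊕ Fin C)} {T : ℕ}
  {α : Fin T → stdSimplex ℝ (Fin M)} {β : Fin T → Fin C → stdSimplex ℝ (Fin N)}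

theorem IsContextSwapPlay.sum_armReward_sub_le (h : G.IsContextSwapPlay A α β) (c : Fin C)
    (σ : Fin N → Fin N ⊕ Fin C) :
    ∑ t, ∑ j, G.armReward (α t) (β t) c j (σ j) - ∑ t, G.learnerMixed (α t) (β t c) c ≤
      ∑ j, (A c j).externalRegret fun t => G.armReward (α t) (β t) c j := by
  simp only [← (h _).sum_mul_armReward G (α _) c]
  rw [Finset.sum_comm, Finset.sum_comm (f := fun t j => ∑ k, _), ← Finset.sum_sub_distrib]
  exact Finset.sum_le_sum fun j _ => (A c j).sum_sub_sum_play_le_externalRegret _ (σ j)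

end Play

section ApproximateEquilibrium

/-- An `ε`-approximate correlated equilibrium: neither misreporting the context nor swapping
actions improves the learner's utility by more than `ε`. -/
def IsApproxCorrelatedEquilibrium (ε : ℝ) (F : Fin C → stdSimplex ℝ (Fin M × Fin N)) : Prop :=
  (∀ c c' : Fin C,
    ∑ a : Fin M × Fin N, (F c').1 a * G.uL a.1 a.2 c ≤
      ∑ a : Fin M × Fin N, (F c).1 a * G.uL a.1 a.2 c + ε) ∧
  (∀ (c : Fin C) (π : Fin N → Fin N),
    ∑ a : Fin M × Fin N, (F c).1 a * G.uL a.1 (π a.2) c ≤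
      ∑ a : Fin M × Fin N, (F c).1 a * G.uL a.1 a.2 c + ε)

/-- The optimizer's best value over all `ε`-approximate correlated equilibria. -/
noncomputable def approxCorrVal (ε : ℝ) : ℝ :=
  sSup (G.optimizerValue '' {F | G.IsApproxCorrelatedEquilibrium ε F})

theorem isApproxCorrelatedEquilibrium_zero :
    G.IsApproxCorrelatedEquilibrium 0 = G.IsCorrelatedEquilibrium := by
  simp only [funext_iff, IsApproxCorrelatedEquilibrium, IsCorrelatedEquilibrium, add_zero,
    implies_true]

variable {G} in
theorem IsApproxCorrelatedEquilibrium.mono {ε ε' : ℝ} (h : ε ≤ ε')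
    {F : Fin C → stdSimplex ℝ (Fin M × Fin N)} (hF : G.IsApproxCorrelatedEquilibrium ε F) :
    G.IsApproxCorrelatedEquilibrium ε' F :=
  ⟨fun c c' => (hF.1 c c').trans (by gcongr), fun c π => (hF.2 c π).trans (by gcongr)⟩

theorem image_isApproxCorrelatedEquilibrium_zero :
    G.optimizerValue '' {F | G.IsApproxCorrelatedEquilibrium 0 F} = G.corrValues := by
  rw [isApproxCorrelatedEquilibrium_zero]
  rfl

theorem approxCorrVal_zero : G.approxCorrVal 0 = G.corrVal :=
  congrArg sSup G.image_isApproxCorrelatedEquilibrium_zero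

theorem continuous_optimizerValue : Continuous G.optimizerValue :=
  continuous_finsetSum _ fun c _ =>
    (continuous_sum_stdSimplex_mul (continuous_apply c) _).const_mul _

theorem isClosed_isApproxCorrelatedEquilibrium :
    IsClosed {q : ℝ × (Fin C → stdSimplex ℝ (Fin M × Fin N)) |
      G.IsApproxCorrelatedEquilibrium q.1 q.2} := by
  simp only [IsApproxCorrelatedEquilibrium, Set.ofPred_and, Set.ofPred_forall]
  have continuous_utility (c : Fin C) (g : Fin M × Fin N → ℝ) :
      Continuous fun q : ℝ × (Fin C → stdSimplex ℝ (Fin M × Fin N)) => ∑ a, (q.2 c).1 a * g a :=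
    continuous_sum_stdSimplex_mul (by fun_prop) g
  refine (isClosed_iInter fun c => isClosed_iInter fun c' => ?_).inter
    (isClosed_iInter fun c => isClosed_iInter fun π => ?_)
  all_goals exact isClosed_le (continuous_utility _ _) ((continuous_utility _ _).add continuous_fst)

theorem optimizerValue_le_approxCorrVal {ε : ℝ} {F : Fin C → stdSimplex ℝ (Fin M × Fin N)}
    (hF : G.IsApproxCorrelatedEquilibrium ε F) : G.optimizerValue F ≤ G.approxCorrVal ε :=
  le_csSup ((isCompact_range G.continuous_optimizerValue).bddAbove.mono
    (Set.image_subset_range _ _)) ⟨F, hF, rfl⟩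

theorem exists_isCorrelatedEquilibrium [NeZero M] [NeZero N] :
    ∃ F, G.IsCorrelatedEquilibrium F := by
  -- The optimizer commits to a pure action, and the learner best-responds in every context.
  choose b hb using fun c => Finite.exists_max fun j => G.uL 0 j c
  refine ⟨fun c => stdSimplex.vertex (0, b c), fun c c' => ?_, fun c π => ?_⟩
  · simpa [Pi.single_apply] using hb c (b c')
  · simpa [Pi.single_apply] using hb c (π (b c))

theorem isGreatest_approxCorrVal [NeZero M] [NeZero N] {ε : ℝ} (hε : 0 ≤ ε) :
    IsGreatest (G.optimizerValue '' {F | G.IsApproxCorrelatedEquilibrium ε F})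
      (G.approxCorrVal ε) := by
  have hclosed : IsClosed {F | G.IsApproxCorrelatedEquilibrium ε F} :=
    G.isClosed_isApproxCorrelatedEquilibrium.preimage (Continuous.prodMk_right ε)
  obtain ⟨F, hF⟩ := G.exists_isCorrelatedEquilibrium
  rw [← isApproxCorrelatedEquilibrium_zero] at hF
  exact (hclosed.isCompact.image G.continuous_optimizerValue).isGreatest_sSup
    (Set.Nonempty.image _ ⟨F, hF.mono hε⟩)

theorem isGreatest_corrVal [NeZero M] [NeZero N] : IsGreatest G.corrValues G.corrVal := by
  rw [← image_isApproxCorrelatedEquilibrium_zero, ← approxCorrVal_zero]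
  exact G.isGreatest_approxCorrVal le_rfl

theorem corrVal_le_approxCorrVal [NeZero M] [NeZero N] {ε : ℝ} (hε : 0 ≤ ε) :
    G.corrVal ≤ G.approxCorrVal ε := by
  obtain ⟨F, hF, hval⟩ := G.isGreatest_corrVal.1
  rw [← isApproxCorrelatedEquilibrium_zero] at hF
  exact hval ▸ G.optimizerValue_le_approxCorrVal (hF.mono hε)

theorem tendsto_approxCorrVal [NeZero M] [NeZero N] :
    Tendsto G.approxCorrVal (𝓝[≥] 0) (𝓝 G.corrVal) := by
  refine tendsto_order.mpr ⟨fun a ha => ?_, fun a ha => ?_⟩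
  · filter_upwards [self_mem_nhdsWithin] with ε hε
    exact ha.trans_le (G.corrVal_le_approxCorrVal hε)
  · have values_lt : ∀ᶠ ε in 𝓝 (0 : ℝ), ∀ F,
        G.IsApproxCorrelatedEquilibrium ε F → G.optimizerValue F < a :=
      eventually_forall_lt_of_isClosed G.isClosed_isApproxCorrelatedEquilibrium
        G.continuous_optimizerValue.upperSemicontinuous fun F hF =>
          (G.optimizerValue_le_approxCorrVal hF).trans_lt (G.approxCorrVal_zero ▸ ha)
    filter_upwards [nhdsWithin_le_nhds values_lt, self_mem_nhdsWithin] with ε hlt hε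
    obtain ⟨F, hF, hval⟩ := (G.isGreatest_approxCorrVal hε).1
    exact hval ▸ hlt F hF

end ApproximateEquilibrium

section EmpiricalPlay

variable {T : ℕ} [NeZero T]

/-- The time average of the product distributions `α t ⊗ β t c`: the correlation between the two
players in context `c` that a whole play induces. -/
noncomputable def empiricalPlay (α : Fin T → stdSimplex ℝ (Fin M))
    (β : Fin T → Fin C → stdSimplex ℝ (Fin N)) (c : Fin C) : stdSimplex ℝ (Fin M × Fin N) :=
  averageDistribution fun t => productDistribution (α t) (β t c)

theorem sum_empiricalPlay_mul (α : Fin T → stdSimplex ℝ (Fin M))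
    (β : Fin T → Fin C → stdSimplex ℝ (Fin N)) (c : Fin C) (g : Fin M × Fin N → ℝ) :
    ∑ a, (empiricalPlay α β c).1 a * g a =
      (∑ t, ∑ a, (productDistribution (α t) (β t c)).1 a * g a) / T := by
  rw [empiricalPlay, sum_averageDistribution_mul, Fintype.card_fin]

theorem optimizerValue_empiricalPlay (α : Fin T → stdSimplex ℝ (Fin M))
    (β : Fin T → Fin C → stdSimplex ℝ (Fin N)) :
    G.optimizerValue (empiricalPlay α β) = (∑ t, G.optimizerReward (α t) (β t)) / T := by
  simp only [optimizerReward_eq_optimizerValue]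
  unfold optimizerValue
  rw [Finset.sum_comm, Finset.sum_div]
  simp only [sum_empiricalPlay_mul, ← Finset.mul_sum, mul_div_assoc]

variable {G} {A : Fin C → Fin N → LearningAlgorithm (Fin N ⊕ Fin C)}
  {α : Fin T → stdSimplex ℝ (Fin M)} {β : Fin T → Fin C → stdSimplex ℝ (Fin N)} {ε : ℝ}

theorem IsContextSwapPlay.isApproxCorrelatedEquilibrium_empiricalPlay
    (h : G.IsContextSwapPlay A α β)
    (hε : ∀ c, ∑ j, (A c j).externalRegret (fun t => G.armReward (α t) (β t) c j) ≤ ε * T) :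
    G.IsApproxCorrelatedEquilibrium ε (empiricalPlay α β) := by
  have hT : (0 : ℝ) < T := Nat.cast_pos'.mpr (NeZero.pos T)
  have deviation_le (c : Fin C) (σ : Fin N → Fin N ⊕ Fin C) :
      (∑ t, ∑ j, G.armReward (α t) (β t) c j (σ j)) / T ≤
        (∑ t, G.learnerMixed (α t) (β t c) c) / T + ε := by
    rw [div_add' _ _ _ hT.ne']
    gcongr
    linarith [h.sum_armReward_sub_le c σ, hε c]
  refine ⟨fun c c' => ?_, fun c π => ?_⟩
  · simpa only [sum_empiricalPlay_mul, sum_armReward_inr, learnerMixed_eq_sum_productDistribution]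
      using deviation_le c fun _ => Sum.inr c'
  · simpa only [sum_empiricalPlay_mul, armReward, sum_productDistribution_mul_uL,
      learnerMixed_eq_sum_productDistribution] using deviation_le c fun j => Sum.inl (π j)

theorem IsContextSwapPlay.sum_optimizerReward_le (h : G.IsContextSwapPlay A α β)
    (hε : ∀ c, ∑ j, (A c j).externalRegret (fun t => G.armReward (α t) (β t) c j) ≤ ε * T) :
    ∑ t, G.optimizerReward (α t) (β t) ≤ G.approxCorrVal ε * T := by
  rw [← div_le_iff₀ (Nat.cast_pos'.mpr (NeZero.pos T)), ← optimizerValue_empiricalPlay]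
  exact G.optimizerValue_le_approxCorrVal (h.isApproxCorrelatedEquilibrium_empiricalPlay hε)

end EmpiricalPlay

end BayesianGame

theorem mainTheorem8 {M N C : ℕ} (hM : 0 < M) (hN : 0 < N) (G : BayesianGame M N C)
    (A : Fin C → Fin N → LearningAlgorithm (Fin N ⊕ Fin C))
    (hA : ∀ c j, (A c j).IsLowRegret) :
    IsGreatest G.corrValues G.corrVal ∧
      ∃ f : ℕ → ℝ, (f =o[atTop] fun T : ℕ => (T : ℝ)) ∧
        ∀ (T : ℕ) (α : Fin T → stdSimplex ℝ (Fin M))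
          (β : Fin T → Fin C → stdSimplex ℝ (Fin N)),
          G.IsContextSwapPlay A α β →
            ∑ t : Fin T, G.optimizerReward (α t) (β t) ≤ G.corrVal * T + f T := by
  have : NeZero M := ⟨hM.ne'⟩
  have : NeZero N := ⟨hN.ne'⟩
  refine ⟨G.isGreatest_corrVal, ?_⟩
  obtain ⟨R, hRo, hR0, hR⟩ := LearningAlgorithm.exists_common_externalRegret_bound
    (A := fun q : Fin C × Fin N => A q.1 q.2) fun q => hA q.1 q.2
  let ε : ℕ → ℝ := fun T => N * R T / T
  have hε : Tendsto ε atTop (𝓝[≥] 0) := tendsto_nhdsWithin_iff.mpr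
    ⟨(hRo.const_mul_left _).tendsto_div_nhds_zero,
      .of_forall fun T => div_nonneg (mul_nonneg N.cast_nonneg (hR0 T)) T.cast_nonneg⟩
  refine ⟨fun T => (G.approxCorrVal (ε T) - G.corrVal) * T, ?_, fun T α β hplay => ?_⟩
  · have gap_isLittleO := (isLittleO_one_iff ℝ).mpr
      (tendsto_sub_nhds_zero_iff.mpr (G.tendsto_approxCorrVal.comp hε))
    simpa using gap_isLittleO.mul_isBigO (isBigO_refl (fun T : ℕ => (T : ℝ)) atTop)
  rcases eq_or_ne T 0 with rfl | hT
  · simp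
  have : NeZero T := ⟨hT⟩
  have regret_le (c : Fin C) :
      ∑ j, (A c j).externalRegret (fun t => G.armReward (α t) (β t) c j) ≤ ε T * T := by
    simpa [ε, hT] using Finset.sum_le_card_nsmul Finset.univ _ (R T) fun j _ =>
      hR (c, j) T _ fun t k => G.armReward_mem_Icc (α t) (β t) c j k
  linarith [hplay.sum_optimizerReward_le regret_le]
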